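/- Let $\mathbb F=\mathbb R$ or $\mathbb C$, and let $\mathfrak g,\tilde{\mathfrak g}$ be finite-dimensional simple Lie algebras over $\mathbb F$, assumed in addition to be compact (i.e. with negative definite Killing form) if $\mathbb F=\mathbb R$. Let $\sigma\in\mathrm{Aut}(\mathfrak g)$ and $\tilde\sigma\in\mathrm{Aut}(\tilde{\mathfrak g})$ be arbitrary ($\mathbb F$-linear Lie algebra) automorphisms, not necessarily of finite order. Let $$L(\mathfrak g,\sigma):=\{u:\mathbb R\to\mathfrak g \mid u\in C^\infty,\ u(t+2\pi)=\sigma u(t)\ \text{for all } t\in\mathbb R\},$$ a Lie algebra over $\mathbb F$ with the pointwise bracket $[u,v](t)=[u(t),v(t)]$, and define $L(\tilde{\mathfrak g},\tilde\sigma)$ in the same way. Theorem 3.1. Every isomorphism of Lie algebras over $\mathbb F$, $\varphi:L(\mathfrak g,\sigma)\to L(\tilde{\mathfrak g},\tilde\sigma)$, is standard: there exist $\epsilon\in\{1,-1\}$, a $C^\infty$ diffeomorphism $\lambda:\mathbb R\to\mathbb R$ and a smooth curve $t\mapsto\varphi_t$ $(t\in\mathbb R)$ of Lie algebra isomorphisms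 $\varphi_t:\mathfrak g\to\tilde{\mathfrak g}$ such that for all $t\in\mathbb R$ $$\lambda(t+2\pi)=\lambda(t)+2\pi\epsilon,\qquad \varphi_{t+2\pi}=\tilde\sigma\,\varphi_t\,\sigma^{-\epsilon},$$ and $$(\varphi u)(t)=\varphi_t\bigl(u(\lambda(t))\bigr)\qquad\text{for all } u\in L(\mathfrak g,\sigma),\ t\in\mathbb R.$$ -/

import Mathlib

open scoped ContDiff Manifold

section SmoothCurve

/-- A curve `c : ℝ → V` in a finite-dimensional vector space over `𝕜` (`ℝ` or `ℂ`) is smooth if it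
is `C^∞` in linear coordinates, i.e. if `ℓ ∘ c` is a `C^∞` function of the real parameter for
every linear functional `ℓ`. In finite dimensions this is smoothness for the unique Hausdorff
vector space topology (equivalently, for any norm), so that no norm on `V` has to be chosen. -/
def IsSmoothCurve (𝕜 : Type*) [RCLike 𝕜] {V : Type*} [AddCommGroup V] [Module 𝕜 V]
    (c : ℝ → V) : Prop :=
  ∀ l : Module.Dual 𝕜 V, ContDiff ℝ ∞ (fun t => l (c t))

variable {𝕜 : Type*} [RCLike 𝕜] {V W : Type*} [AddCommGroup V] [Module 𝕜 V]
  [AddCommGroup W] [Module 𝕜 W]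

theorem IsSmoothCurve.bilin [FiniteDimensional 𝕜 V] (B : V →ₗ[𝕜] V →ₗ[𝕜] W) {u v : ℝ → V}
    (hu : IsSmoothCurve 𝕜 u) (hv : IsSmoothCurve 𝕜 v) :
    IsSmoothCurve 𝕜 (fun t => B (u t) (v t)) := by
  intro l
  let b := Module.finBasis 𝕜 V
  have key : (fun t => l (B (u t) (v t))) = fun t =>
      ∑ i, ∑ j, b.coord i (u t) * (b.coord j (v t) * l (B (b i) (b j))) := by
    funext t
    conv_lhs => rw [← b.sum_repr (u t), ← b.sum_repr (v t)]
    simp only [map_sum, map_smul, LinearMap.sum_apply, LinearMap.smul_apply, smul_eq_mul,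
      Module.Basis.coord_apply, Finset.mul_sum]
    rw [Finset.sum_comm]
    exact Finset.sum_congr rfl fun i _ => Finset.sum_congr rfl fun j _ => by ring
  rw [key]
  exact ContDiff.sum fun i _ => ContDiff.sum fun j _ =>
    (hu (b.coord i)).mul ((hv (b.coord j)).mul contDiff_const)

end SmoothCurve

section LoopAlgebra

/-- Functions `ℝ → 𝔤` with the pointwise bracket `⁅u, v⁆ t = ⁅u t, v t⁆`. -/
instance funLieRing {L : Type*} [LieRing L] : LieRing (ℝ → L) where
  bracket u v := fun t => ⁅u t, v t⁆
  add_lie u v w := funext fun t => add_lie (u t) (v t) (w t)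
  lie_add u v w := funext fun t => lie_add (u t) (v t) (w t)
  lie_self u := funext fun t => lie_self (u t)
  leibniz_lie u v w := funext fun t => leibniz_lie (u t) (v t) (w t)

instance funLieAlgebra {𝕜 : Type*} [CommRing 𝕜] {L : Type*} [LieRing L] [LieAlgebra 𝕜 L] :
    LieAlgebra 𝕜 (ℝ → L) where
  lie_smul c u v := funext fun t => lie_smul c (u t) (v t)

/-- The Lie algebra `L` over `𝕜` (`ℝ` or `ℂ`) is compact in case `𝕜 = ℝ` (that is, in case the
imaginary unit `RCLike.I` of `𝕜` is `0`): its Killing form is negative definite.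
There is no condition if `𝕜 = ℂ`. -/
def IsCompactIfReal (𝕜 : Type*) [RCLike 𝕜] (L : Type*) [LieRing L] [LieAlgebra 𝕜 L] : Prop :=
  (RCLike.I : 𝕜) = 0 → ∀ x : L, x ≠ 0 → RCLike.re (killingForm 𝕜 L x x) < 0

variable {𝕜 : Type*} [RCLike 𝕜]
  {L : Type*} [LieRing L] [LieAlgebra 𝕜 L] [FiniteDimensional 𝕜 L]
  {L' : Type*} [LieRing L'] [LieAlgebra 𝕜 L'] [FiniteDimensional 𝕜 L']

/-- The smooth twisted loop algebra `L(𝔤, σ)`: all smooth `u : ℝ → 𝔤` with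
`u (t + 2π) = σ (u t)`, with pointwise operations and pointwise bracket. -/
def twistedLoopAlgebra (σ : L ≃ₗ⁅𝕜⁆ L) : LieSubalgebra 𝕜 (ℝ → L) where
  carrier := {u | IsSmoothCurve 𝕜 u ∧ ∀ t, u (t + 2 * Real.pi) = σ (u t)}
  add_mem' := by
    rintro u v ⟨hu, hu'⟩ ⟨hv, hv'⟩
    refine ⟨fun l => ?_, fun t => ?_⟩
    · simpa using (hu l).add (hv l)
    · simp [hu', hv']
  zero_mem' := ⟨fun l => by simpa using contDiff_const, fun t => by simp⟩
  smul_mem' := by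
    rintro c u ⟨hu, hu'⟩
    refine ⟨fun l => ?_, fun t => ?_⟩
    · simpa using contDiff_const.mul (hu l)
    · simp [hu']
  lie_mem' := by
    rintro u v ⟨hu, hu'⟩ ⟨hv, hv'⟩
    refine ⟨?_, fun t => ?_⟩
    · exact hu.bilin (LinearMap.mk₂ 𝕜 (fun x y : L => ⁅x, y⁆) add_lie smul_lie lie_add lie_smul) hv
    · change ⁅u (t + 2 * Real.pi), v (t + 2 * Real.pi)⁆ = σ ⁅u t, v t⁆
      rw [hu', hv', LieEquiv.map_lie]

/-- An isomorphism `φ : L(𝔤, σ) → L(𝔤', σ')` is standard if `φ u (t) = Φ_t (u (lam t))` where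
`lam` is a smooth diffeomorphism of `ℝ` with `lam (t + 2π) = lam t + ε 2π`, `ε = ±1`, and `t ↦ Φ_t`
is a smooth curve of Lie algebra isomorphisms `𝔤 → 𝔤'` with `Φ_{t + 2π} = σ' Φ_t σ^{-ε}`. -/
def IsStandard {σ : L ≃ₗ⁅𝕜⁆ L} {σ' : L' ≃ₗ⁅𝕜⁆ L'}
    (φ : twistedLoopAlgebra σ ≃ₗ⁅𝕜⁆ twistedLoopAlgebra σ') : Prop :=
  ∃ (ε : ℤ) (lam : Diffeomorph 𝓘(ℝ, ℝ) 𝓘(ℝ, ℝ) ℝ ℝ ∞) (Φ : ℝ → (L ≃ₗ⁅𝕜⁆ L')),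
    (ε = 1 ∨ ε = -1) ∧
    (∀ t, lam (t + 2 * Real.pi) = lam t + ε * (2 * Real.pi)) ∧
    IsSmoothCurve 𝕜 (fun t => ((Φ t).toLinearEquiv : L →ₗ[𝕜] L')) ∧
    (∀ t x, Φ (t + 2 * Real.pi) x = σ' (Φ t ((σ.toLinearEquiv ^ (-ε)) x))) ∧
    ∀ (u : twistedLoopAlgebra σ) (t : ℝ),
      (φ u : ℝ → L') t = Φ t ((u : ℝ → L) (lam t))

end LoopAlgebra

/-!
Let `C` be the algebra of smooth `2π`-periodic functions `ℝ → 𝕜`; it acts on twisted loop algebras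
by pointwise multiplication. The theorem follows from a description of the Lie algebra homomorphisms
`ψ` of `L(𝔤, σ)` onto a simple Lie algebra `𝔤'` as in the statement: each is an evaluation
`u ↦ u s` followed by an isomorphism `𝔤 ≃ 𝔤'` (`exists_lieEquiv_apply_eq`).

Indeed, the identity `⁅f u, v⁆ = ⁅u, f v⁆` and the triviality of the centre of `𝔤'` show that the
kernel of `ψ` is stable under `C`, so that `C` acts on `𝔤'` by endomorphisms that commute with the
adjoint representation. These are scalars (`exists_eq_smul_of_map_lie`): they have an eigenvalue,
over `ℂ` trivially and over `ℝ` because they are self-adjoint for the definite Killing form, and the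
eigenspace is an ideal. Hence `ψ (f u) = χ f • ψ u` for a character `χ` of `C`, and every
character of `C` is the evaluation at a point `s` (`periodicSmooth.exists_character_eq_eval`).
Multiplying by cutoff functions one writes `u` near `s` as a `C`-linear combination of loops that are
locally constant there, and concludes that `ψ u` depends only on `u s`.

Applied to `u ↦ φ u t` this gives `φ u t = Φ_t (u (lam t))` with `lam t` unique modulo `2π`. For
`f ∈ C` the function `f ∘ lam` is locally a quotient of coordinates of `φ (f u)` and `φ u`, so
`cos ∘ lam` and `sin ∘ lam` are smooth and `lam` can be chosen smooth by lifting the angle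
(`exists_contDiff_forall_apply_eq`). The same for the inverse of `φ` gives a map `mu` which is
inverse to `lam` up to a translation by a multiple of `2π`. So `lam` is a diffeomorphism, the
degrees of `lam` and `mu` are inverse integers, and the remaining claims are read off from
`φ u t = Φ_t (u (lam t))`.
-/

/-! ### The centroid of a simple Lie algebra -/

section Centroid

variable {𝕜 : Type*} [RCLike 𝕜] {L : Type*} [LieRing L] [LieAlgebra 𝕜 L]

theorem RCLike.isAlgClosed_of_I_ne_zero (h : (RCLike.I : 𝕜) ≠ 0) : IsAlgClosed 𝕜 := by
  let e : 𝕜 ≃+* ℂ := RCLike.complexRingEquiv ((RCLike.I_eq_zero_or_im_I_eq_one).resolve_left h)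
  refine IsAlgClosed.of_exists_root _ fun p _ hp => ?_
  obtain ⟨z, hz⟩ := IsAlgClosed.exists_root (p.map e.toRingHom) (by
    rw [Polynomial.degree_map]; exact hp.degree_pos.ne')
  refine ⟨e.symm z, e.injective ?_⟩
  rw [Polynomial.IsRoot, Polynomial.eval_map] at hz
  have := Polynomial.hom_eval₂ p (RingHom.id 𝕜) e.toRingHom (e.symm z)
  rw [Polynomial.eval₂_id, RingHom.comp_id] at this
  rw [map_zero, ← hz]
  simpa using this

theorem LieAlgebra.IsSimple.eq_zero_of_forall_lie_eq_zero [LieAlgebra.IsSimple 𝕜 L] {x : L}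
    (hx : ∀ y : L, ⁅x, y⁆ = 0) : x = 0 := by
  have hc : LieAlgebra.center 𝕜 L = ⊥ :=
    (LieAlgebra.IsSimple.eq_bot_or_eq_top (R := 𝕜) (LieAlgebra.center 𝕜 L)).resolve_right
      fun h => LieAlgebra.IsSimple.non_abelian 𝕜 (L := L)
        ((LieAlgebra.isLieAbelian_iff_center_eq_top 𝕜 L).2 h)
  have : x ∈ LieAlgebra.center 𝕜 L := by
    rw [LieModule.mem_maxTrivSubmodule]
    intro y
    rw [← lie_skew, hx, neg_zero]
  simpa [hc] using this

/-- For `𝕜 = ℝ` a centroid element is self-adjoint for the definite Killing form, and so has a real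
eigenvalue. -/
theorem exists_hasEigenvalue_of_map_lie [FiniteDimensional 𝕜 L] [Nontrivial L]
    (hL : IsCompactIfReal 𝕜 L) (T : Module.End 𝕜 L) (hT : ∀ x y : L, T ⁅x, y⁆ = ⁅T x, y⁆) :
    ∃ c : 𝕜, T.HasEigenvalue c := by
  by_cases hI : (RCLike.I : 𝕜) = 0
  · have hre : ∀ z : 𝕜, (starRingEnd 𝕜) z = z := fun z => by
      rw [RCLike.conj_eq_iff_im, ← RCLike.mul_im_I_ax, hI]; simp
    let core : InnerProductSpace.Core 𝕜 L :=
      { inner := fun x y => -killingForm 𝕜 L x y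
        conj_inner_symm := fun x y => by
          rw [hre, LieModule.traceForm_comm]
        re_inner_nonneg := fun x => by
          by_cases hx : x = 0
          · simp [hx]
          · simpa using (hL hI x hx).le
        add_left := fun x y z => by simp [add_comm]
        smul_left := fun x y r => by simp [hre]
        definite := fun x hx => by
          by_contra h
          have := hL hI x h
          rw [neg_eq_zero] at hx
          simp [hx] at this }
    let _ : NormedAddCommGroup L := core.toNormedAddCommGroup
    let _ : InnerProductSpace 𝕜 L := InnerProductSpace.ofCore core.toCore
    have hsymm : T.IsSymmetric := by
      intro x y
      change -killingForm 𝕜 L (T x) y = -killingForm 𝕜 L x (T y)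
      have h1 : LieAlgebra.ad 𝕜 L (T x) = LieAlgebra.ad 𝕜 L x ∘ₗ T := by
        ext z
        simp only [LieAlgebra.ad_apply, LinearMap.comp_apply]
        rw [← hT, ← lie_skew x (T z), ← hT, ← map_neg, lie_skew]
      have h2 : LieAlgebra.ad 𝕜 L (T y) = T ∘ₗ LieAlgebra.ad 𝕜 L y := by
        ext z
        simp [hT]
      rw [killingForm_apply_apply, killingForm_apply_apply, h1, h2, LinearMap.comp_assoc]
    by_contra! hno
    exact not_subsingleton L (hsymm.subsingleton_of_no_eigenvalue_finiteDimensional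
      fun c => not_not.1 (hno c))
  · have := RCLike.isAlgClosed_of_I_ne_zero hI
    exact Module.End.exists_eigenvalue T

/-- Schur's lemma: an eigenspace of a centroid element is a nonzero ideal. -/
theorem exists_eq_smul_of_map_lie [FiniteDimensional 𝕜 L] [LieAlgebra.IsSimple 𝕜 L]
    (hL : IsCompactIfReal 𝕜 L) (T : Module.End 𝕜 L) (hT : ∀ x y : L, T ⁅x, y⁆ = ⁅T x, y⁆) :
    ∃ c : 𝕜, ∀ x, T x = c • x := by
  have : Nontrivial L := LieAlgebra.IsSimple.nontrivial 𝕜 L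
  obtain ⟨c, hc⟩ := exists_hasEigenvalue_of_map_lie hL T hT
  let I : LieIdeal 𝕜 L :=
    { T.eigenspace c with
      lie_mem := by
        intro x m hm
        have hm' : T m = c • m := Module.End.mem_eigenspace_iff.1 hm
        refine Module.End.mem_eigenspace_iff.2 ?_
        rw [← lie_skew, map_neg, hT, hm', smul_lie, smul_neg] }
  have hI : I ≠ ⊥ := by
    intro h
    refine hc ?_
    change T.eigenspace c = ⊥
    rw [eq_bot_iff]
    intro x hx
    have : x ∈ I := hx
    simpa [h] using this
  have htop := (LieAlgebra.IsSimple.eq_bot_or_eq_top (R := 𝕜) I).resolve_left hI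
  refine ⟨c, fun x => ?_⟩
  have : x ∈ I := by rw [htop]; trivial
  exact Module.End.mem_eigenspace_iff.1 this

end Centroid

/-! ### The algebra of smooth periodic functions -/

section PeriodicFunctions

variable (𝕜 : Type*) [RCLike 𝕜]

/-- The algebra of smooth `2π`-periodic functions `ℝ → 𝕜`. -/
def periodicSmooth : Subalgebra 𝕜 (ℝ → 𝕜) where
  carrier := {f | ContDiff ℝ ∞ f ∧ Function.Periodic f (2 * Real.pi)}
  add_mem' hf hg := ⟨hf.1.add hg.1, hf.2.add hg.2⟩
  mul_mem' hf hg := ⟨hf.1.mul hg.1, hf.2.mul hg.2⟩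
  algebraMap_mem' _ := ⟨contDiff_const, fun _ => rfl⟩

namespace periodicSmooth

/-- The cosine, as an element of `periodicSmooth 𝕜`. -/
noncomputable def cos : periodicSmooth 𝕜 :=
  ⟨fun t => (Real.cos t : 𝕜), (RCLike.ofRealCLM (K := 𝕜)).contDiff.comp Real.contDiff_cos,
    fun t => by simp⟩

/-- The sine, as an element of `periodicSmooth 𝕜`. -/
noncomputable def sin : periodicSmooth 𝕜 :=
  ⟨fun t => (Real.sin t : 𝕜), (RCLike.ofRealCLM (K := 𝕜)).contDiff.comp Real.contDiff_sin,
    fun t => by simp⟩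

variable {𝕜}

theorem exists_eq_add_of_cos_eq_of_sin_eq {s t : ℝ} (hc : (cos 𝕜 : ℝ → 𝕜) s = (cos 𝕜 : ℝ → 𝕜) t)
    (hs : (sin 𝕜 : ℝ → 𝕜) s = (sin 𝕜 : ℝ → 𝕜) t) : ∃ k : ℤ, s = t + k * (2 * Real.pi) := by
  have h := Real.Angle.cos_sin_inj (RCLike.ofReal_injective hc) (RCLike.ofReal_injective hs)
  obtain ⟨k, hk⟩ := Real.Angle.angle_eq_iff_two_pi_dvd_sub.1 h
  exact ⟨k, by linarith⟩

theorem apply_add_int_mul (f : periodicSmooth 𝕜) (t : ℝ) (k : ℤ) :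
    (f : ℝ → 𝕜) (t + k * (2 * Real.pi)) = (f : ℝ → 𝕜) t :=
  f.2.2.int_mul k t

/-- The smooth periodic function `|f - c|²`. It lies in the ideal generated by `f - c`. -/
def normSqSub (f : periodicSmooth 𝕜) (c : 𝕜) : periodicSmooth 𝕜 :=
  (f - algebraMap 𝕜 _ c) * ⟨fun t => (starRingEnd 𝕜) ((f : ℝ → 𝕜) t - c),
    (RCLike.conjCLE (K := 𝕜)).contDiff.comp (f.2.1.sub contDiff_const), fun t => by
      simp only [f.2.2 t]⟩

theorem normSqSub_apply (f : periodicSmooth 𝕜) (c : 𝕜) (t : ℝ) :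
    (normSqSub f c : ℝ → 𝕜) t = ((‖(f : ℝ → 𝕜) t - c‖ ^ 2 : ℝ) : 𝕜) := by
  have := RCLike.mul_conj ((f : ℝ → 𝕜) t - c)
  push_cast
  exact this

theorem map_normSqSub (χ : periodicSmooth 𝕜 →ₐ[𝕜] 𝕜) (f : periodicSmooth 𝕜) :
    χ (normSqSub f (χ f)) = 0 := by
  rw [normSqSub, map_mul, map_sub, AlgHom.commutes]
  simp

theorem exists_apply_eq_zero_of_map_eq_zero (χ : periodicSmooth 𝕜 →ₐ[𝕜] 𝕜) {f : periodicSmooth 𝕜}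
    (hf : χ f = 0) : ∃ t, (f : ℝ → 𝕜) t = 0 := by
  by_contra! h
  let g : periodicSmooth 𝕜 := ⟨fun t => ((f : ℝ → 𝕜) t)⁻¹, f.2.1.inv h, fun t => by
    simp only [f.2.2 t]⟩
  have hfg : f * g = 1 := Subtype.ext (funext fun t => mul_inv_cancel₀ (h t))
  have := congrArg χ hfg
  rw [map_mul, hf, zero_mul, map_one] at this
  exact zero_ne_one this

/-- Every character is an evaluation: the function `|cos - χ cos|² + |sin - χ sin|² + |f - χ f|²`
is in the kernel of `χ`, so it has a zero, and the first two summands determine this zero modulo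
`2π`. -/
theorem exists_character_eq_eval (χ : periodicSmooth 𝕜 →ₐ[𝕜] 𝕜) :
    ∃ s : ℝ, ∀ f : periodicSmooth 𝕜, χ f = (f : ℝ → 𝕜) s := by
  have key : ∀ f : periodicSmooth 𝕜, ∃ s : ℝ, (cos 𝕜 : ℝ → 𝕜) s = χ (cos 𝕜) ∧
      (sin 𝕜 : ℝ → 𝕜) s = χ (sin 𝕜) ∧ (f : ℝ → 𝕜) s = χ f := by
    intro f
    obtain ⟨s, hs⟩ := exists_apply_eq_zero_of_map_eq_zero χ
      (f := normSqSub (cos 𝕜) (χ (cos 𝕜)) + normSqSub (sin 𝕜) (χ (sin 𝕜)) + normSqSub f (χ f))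
      (by simp only [map_add, map_normSqSub, add_zero])
    have hs' : (normSqSub (cos 𝕜) (χ (cos 𝕜)) : ℝ → 𝕜) s + (normSqSub (sin 𝕜) (χ (sin 𝕜)) : ℝ → 𝕜) s
      + (normSqSub f (χ f) : ℝ → 𝕜) s = 0 := hs
    simp only [normSqSub_apply] at hs'
    norm_cast at hs'
    have h1 := sq_nonneg ‖(cos 𝕜 : ℝ → 𝕜) s - χ (cos 𝕜)‖
    have h2 := sq_nonneg ‖(sin 𝕜 : ℝ → 𝕜) s - χ (sin 𝕜)‖
    have h3 := sq_nonneg ‖(f : ℝ → 𝕜) s - χ f‖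
    refine ⟨s, ?_, ?_, ?_⟩ <;> rw [← sub_eq_zero, ← norm_eq_zero, ← sq_eq_zero_iff] <;> linarith
  obtain ⟨s, hc, hs, -⟩ := key 1
  refine ⟨s, fun f => ?_⟩
  obtain ⟨s', hc', hs', hf⟩ := key f
  obtain ⟨k, rfl⟩ := exists_eq_add_of_cos_eq_of_sin_eq (hc'.trans hc.symm) (hs'.trans hs.symm)
  rw [← hf, apply_add_int_mul]

end periodicSmooth

end PeriodicFunctions

/-! ### Lifting of angles -/

section Lifting

/-- A smooth curve on the unit circle is lifted to the line by `θ = θ₀ + ∫ (c s' - s c')`. -/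
theorem exists_contDiff_cos_eq_sin_eq {c s : ℝ → ℝ} (hc : ContDiff ℝ ∞ c) (hs : ContDiff ℝ ∞ s)
    (h : ∀ t, c t ^ 2 + s t ^ 2 = 1) :
    ∃ θ : ℝ → ℝ, ContDiff ℝ ∞ θ ∧ ∀ t, Real.cos (θ t) = c t ∧ Real.sin (θ t) = s t := by
  have hc' := (contDiff_infty_iff_deriv.1 hc)
  have hs' := (contDiff_infty_iff_deriv.1 hs)
  have hz : ‖(⟨c 0, s 0⟩ : ℂ)‖ = 1 := by
    rw [← sq_eq_sq₀ (norm_nonneg _) zero_le_one, ← Complex.normSq_eq_norm_sq, Complex.normSq_mk]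
    linarith [h 0]
  have hz0 : (⟨c 0, s 0⟩ : ℂ) ≠ 0 := by
    intro h0; rw [h0] at hz; simp at hz
  have h0c := Complex.cos_arg hz0
  have h0s := Complex.sin_arg (⟨c 0, s 0⟩ : ℂ)
  rw [hz, div_one] at h0c h0s
  set θ₀ := Complex.arg ⟨c 0, s 0⟩
  set w : ℝ → ℝ := fun t => c t * deriv s t - s t * deriv c t with hw
  have hwc : ContDiff ℝ ∞ w := (hc.mul hs'.2).sub (hs.mul hc'.2)
  set θ : ℝ → ℝ := fun t => θ₀ + ∫ x in (0 : ℝ)..t, w x with hθ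
  have hθd : ∀ t, HasDerivAt θ (w t) t := fun t =>
    (intervalIntegral.integral_hasDerivAt_right (hwc.continuous.intervalIntegrable _ _)
      (hwc.continuous.stronglyMeasurableAtFilter _ _) hwc.continuous.continuousAt).const_add θ₀
  have hθc : ContDiff ℝ ∞ θ := by
    rw [contDiff_infty_iff_deriv]
    refine ⟨fun t => (hθd t).differentiableAt, ?_⟩
    rwa [show deriv θ = w from funext fun t => (hθd t).deriv]
  -- The inner product of `(c, s)` and `(cos θ, sin θ)` is constant.
  have hP : ∀ t, HasDerivAt (fun t => c t * Real.cos (θ t) + s t * Real.sin (θ t)) 0 t := by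
    intro t
    have hct := (hc'.1 t).hasDerivAt
    have hst := (hs'.1 t).hasDerivAt
    have h2 : c t * deriv c t + s t * deriv s t = 0 := by
      have e1 := (hct.pow 2).add (hst.pow 2)
      have e2 : (c ^ 2 + s ^ 2) = fun _ => (1 : ℝ) := funext h
      rw [e2] at e1
      have := e1.unique (hasDerivAt_const t (1 : ℝ))
      norm_num at this
      linarith
    refine ((hct.mul (hθd t).cos).add (hst.mul (hθd t).sin)).congr_deriv ?_
    simp only [hw]
    linear_combination (c t * Real.cos (θ t) + s t * Real.sin (θ t)) * h2
      - (deriv c t * Real.cos (θ t) + deriv s t * Real.sin (θ t)) * h t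
  have hconst : ∀ t, c t * Real.cos (θ t) + s t * Real.sin (θ t) = 1 := by
    intro t
    have := is_const_of_deriv_eq_zero (fun t => (hP t).differentiableAt) (fun t => (hP t).deriv) t 0
    rw [this]
    have : θ 0 = θ₀ := by simp [hθ]
    rw [this, h0c, h0s]
    change c 0 * c 0 + s 0 * s 0 = 1
    linarith [h 0]
  refine ⟨θ, hθc, fun t => ?_⟩
  have h1 := hconst t
  have h2 := h t
  have h3 := Real.cos_sq_add_sin_sq (θ t)
  have h4 : (Real.cos (θ t) - c t) ^ 2 + (Real.sin (θ t) - s t) ^ 2 = 0 := by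
    linear_combination h2 + h3 - 2 * h1
  constructor
  · nlinarith [sq_nonneg (Real.cos (θ t) - c t), sq_nonneg (Real.sin (θ t) - s t)]
  · nlinarith [sq_nonneg (Real.cos (θ t) - c t), sq_nonneg (Real.sin (θ t) - s t)]

theorem exists_eq_of_continuous_of_forall_exists_int {f : ℝ → ℝ} (hf : Continuous f) {a : ℝ}
    (ha : a ≠ 0) (h : ∀ t, ∃ k : ℤ, f t = k * a) : ∃ k : ℤ, ∀ t, f t = k * a := by
  choose k hk using h
  have hk' : Continuous k := by
    rw [Int.isClosedEmbedding_coe_real.isEmbedding.continuous_iff]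
    have : ((↑) : ℤ → ℝ) ∘ k = fun t => f t / a := funext fun t => by simp [hk, ha]
    rw [this]
    exact hf.div_const a
  exact ⟨k 0, fun t => by rw [hk, PreconnectedSpace.constant inferInstance hk' (x := t) (y := 0)]⟩

end Lifting

/-! ### Extending local curves to twisted loops -/

section Periodize

variable {𝕜 : Type*} [RCLike 𝕜] {V : Type*} [AddCommGroup V] [Module 𝕜 V]

/-- The curve that agrees with `c` on `[s - π, s + π)` and satisfies `u (t + 2π) = A (u t)`. -/
noncomputable def periodize (A : V ≃ₗ[𝕜] V) (s : ℝ) (c : ℝ → V) (t : ℝ) : V :=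
  (A ^ round ((t - s) / (2 * Real.pi))) (c (t - round ((t - s) / (2 * Real.pi)) * (2 * Real.pi)))

theorem periodize_add_two_pi (A : V ≃ₗ[𝕜] V) (s : ℝ) (c : ℝ → V) (t : ℝ) :
    periodize A s c (t + 2 * Real.pi) = A (periodize A s c t) := by
  have h : (t + 2 * Real.pi - s) / (2 * Real.pi) = (t - s) / (2 * Real.pi) + 1 := by
    field_simp
    ring
  rw [periodize, h, round_add_one, add_comm _ (1 : ℤ), zpow_add, zpow_one, LinearEquiv.mul_apply,
    periodize]
  congr 3
  push_cast
  ring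

theorem periodize_of_abs_sub_lt (A : V ≃ₗ[𝕜] V) {s : ℝ} (c : ℝ → V) {t : ℝ} (h : |t - s| < 2) :
    periodize A s c t = c t := by
  have h0 : round ((t - s) / (2 * Real.pi)) = 0 := by
    have hπ := Real.pi_gt_three
    rw [abs_lt] at h
    rw [round_eq_zero_iff, Set.mem_Ico, le_div_iff₀ (by positivity), div_lt_iff₀ (by positivity)]
    constructor <;> linarith
  simp [periodize, h0]

theorem abs_sub_round_mul_le (x : ℝ) :
    |x - round (x / (2 * Real.pi)) * (2 * Real.pi)| ≤ Real.pi := by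
  have hπ := Real.pi_pos
  have h := abs_sub_round (x / (2 * Real.pi))
  have e : x - round (x / (2 * Real.pi)) * (2 * Real.pi)
      = (x / (2 * Real.pi) - round (x / (2 * Real.pi))) * (2 * Real.pi) := by
    field_simp
  rw [e, abs_mul, abs_of_pos (by positivity : 0 < 2 * Real.pi)]
  nlinarith

/-- Smoothness holds for curves supported in an interval shorter than the period, so that the
translates of the support do not meet. -/
theorem IsSmoothCurve.periodize (A : V ≃ₗ[𝕜] V) {s : ℝ} {c : ℝ → V} (hc : IsSmoothCurve 𝕜 c)
    (h : ∀ t, 2 ≤ |t - s| → c t = 0) : IsSmoothCurve 𝕜 (periodize A s c) := by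
  intro l
  rw [contDiff_iff_contDiffAt]
  intro t₀
  set k₀ := round ((t₀ - s) / (2 * Real.pi)) with hk₀
  have hsm : ContDiff ℝ ∞ (fun t => (l ∘ₗ (A ^ k₀ : V ≃ₗ[𝕜] V).toLinearMap)
      (c (t - k₀ * (2 * Real.pi)))) :=
    (hc _).comp (contDiff_id.sub contDiff_const)
  refine hsm.contDiffAt.congr_of_eventuallyEq ?_
  filter_upwards [Metric.ball_mem_nhds t₀ one_pos] with t ht
  rw [Metric.mem_ball, Real.dist_eq, abs_lt] at ht
  rw [_root_.periodize, LinearMap.comp_apply, LinearEquiv.coe_coe]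
  by_cases hk : round ((t - s) / (2 * Real.pi)) = k₀
  · rw [hk]
  -- Near a jump of the rounding both translates of `c` vanish, because `2 ≤ π - 1`.
  · have hπ := Real.pi_gt_three
    have h1 := abs_sub_round_mul_le (t - s)
    have h2 := abs_sub_round_mul_le (t₀ - s)
    rw [← hk₀] at h2
    set k := round ((t - s) / (2 * Real.pi))
    rw [abs_le] at h1 h2
    have h3 : (k : ℝ) + 1 ≤ k₀ ∨ (k₀ : ℝ) + 1 ≤ k := by
      rcases lt_or_gt_of_ne hk with h | h
      · left; exact_mod_cast h
      · right; exact_mod_cast h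
    have hk₁ : c (t - k * (2 * Real.pi)) = 0 := by
      refine h _ (le_abs.2 ?_)
      rcases h3 with h3 | h3
      · left; nlinarith
      · right; nlinarith
    have hk₂ : c (t - k₀ * (2 * Real.pi)) = 0 := by
      refine h _ (le_abs.2 ?_)
      rcases h3 with h3 | h3
      · right; nlinarith
      · left; nlinarith
    rw [hk₁, hk₂]
    simp only [map_zero]

variable (𝕜)

/-- A smooth function that is `1` on `[s - 1, s + 1]` and vanishes off `(s - 2, s + 2)`. -/
noncomputable def cutoff (s t : ℝ) : 𝕜 :=
  (((⟨1, 2, one_pos, one_lt_two⟩ : ContDiffBump s) t : ℝ) : 𝕜)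

theorem contDiff_cutoff (s : ℝ) : ContDiff ℝ ∞ (cutoff 𝕜 s) :=
  (RCLike.ofRealCLM (K := 𝕜)).contDiff.comp (ContDiffBump.contDiff _)

variable {𝕜}

theorem cutoff_eq_one {s t : ℝ} (h : |t - s| ≤ 1) : cutoff 𝕜 s t = 1 := by
  rw [cutoff, ContDiffBump.one_of_mem_closedBall, RCLike.ofReal_one]
  rwa [Metric.mem_closedBall, Real.dist_eq]

theorem cutoff_eq_zero {s t : ℝ} (h : 2 ≤ |t - s|) : cutoff 𝕜 s t = 0 := by
  rw [cutoff, ContDiffBump.zero_of_le_dist, RCLike.ofReal_zero]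
  rwa [Real.dist_eq]

theorem IsSmoothCurve.cutoff_smul {c : ℝ → V} (hc : IsSmoothCurve 𝕜 c) (s : ℝ) :
    IsSmoothCurve 𝕜 (fun t => cutoff 𝕜 s t • c t) := by
  intro l
  simp only [map_smul, smul_eq_mul]
  exact (contDiff_cutoff 𝕜 s).mul (hc l)

theorem isSmoothCurve_iff_contDiff {f : ℝ → 𝕜} : IsSmoothCurve 𝕜 f ↔ ContDiff ℝ ∞ f := by
  refine ⟨fun h => h LinearMap.id, fun h l => ?_⟩
  have : (fun t => l (f t)) = fun t => f t * l 1 := funext fun t => by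
    rw [← smul_eq_mul, ← map_smul, smul_eq_mul, mul_one]
  rw [this]
  exact h.mul contDiff_const

theorem isSmoothCurve_const (x : V) : IsSmoothCurve 𝕜 (fun _ => x) := fun _ => contDiff_const

/-- The smooth periodic function obtained from `f` by cutting it off around `s`. -/
noncomputable def periodicSmooth.ofLocal (s : ℝ) {f : ℝ → 𝕜} (hf : ContDiff ℝ ∞ f) :
    periodicSmooth 𝕜 :=
  ⟨periodize 1 s (fun t => cutoff 𝕜 s t • f t),
    isSmoothCurve_iff_contDiff.1 (((isSmoothCurve_iff_contDiff.2 hf).cutoff_smul s).periodize 1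
      fun t ht => by rw [cutoff_eq_zero ht, zero_smul]),
    fun t => periodize_add_two_pi 1 s _ t⟩

theorem periodicSmooth.ofLocal_apply_self (s : ℝ) {f : ℝ → 𝕜} (hf : ContDiff ℝ ∞ f) :
    (periodicSmooth.ofLocal s hf : ℝ → 𝕜) s = f s := by
  have h0 : |s - s| = 0 := by simp
  change periodize 1 s (fun t => cutoff 𝕜 s t • f t) s = f s
  rw [periodize_of_abs_sub_lt _ _ (h0.trans_lt two_pos), cutoff_eq_one (h0.trans_le zero_le_one), one_smul]

end Periodize

section TwistedLoop

variable {𝕜 : Type*} [RCLike 𝕜]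
  {L : Type*} [LieRing L] [LieAlgebra 𝕜 L] [FiniteDimensional 𝕜 L] {σ : L ≃ₗ⁅𝕜⁆ L}

namespace twistedLoopAlgebra

/-- The twisted loop obtained from the smooth curve `c` by cutting it off around `s`. -/
noncomputable def ofLocal (σ : L ≃ₗ⁅𝕜⁆ L) (s : ℝ) {c : ℝ → L} (hc : IsSmoothCurve 𝕜 c) :
    twistedLoopAlgebra σ :=
  ⟨periodize σ.toLinearEquiv s (fun t => cutoff 𝕜 s t • c t),
    (hc.cutoff_smul s).periodize σ.toLinearEquiv fun t ht => by rw [cutoff_eq_zero ht, zero_smul],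
    fun t => periodize_add_two_pi σ.toLinearEquiv s _ t⟩

theorem ofLocal_apply_of_abs_sub_le {s : ℝ} {c : ℝ → L} (hc : IsSmoothCurve 𝕜 c) {t : ℝ}
    (ht : |t - s| ≤ 1) : (ofLocal σ s hc : ℝ → L) t = c t := by
  change periodize σ.toLinearEquiv s (fun t => cutoff 𝕜 s t • c t) t = c t
  rw [periodize_of_abs_sub_lt _ _ (ht.trans_lt one_lt_two), cutoff_eq_one ht, one_smul]

theorem apply_add_int_mul (u : twistedLoopAlgebra σ) (t : ℝ) (k : ℤ) :
    (u : ℝ → L) (t + k * (2 * Real.pi)) = (σ.toLinearEquiv ^ k) ((u : ℝ → L) t) := by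
  induction k using Int.induction_on with
  | zero => simp
  | succ n ih =>
    rw [add_comm (n : ℤ) 1, zpow_add, zpow_one, LinearEquiv.mul_apply, ← ih]
    push_cast
    rw [show t + (1 + (n : ℝ)) * (2 * Real.pi) = t + n * (2 * Real.pi) + 2 * Real.pi by ring]
    exact u.2.2 _
  | pred n ih =>
    have h := u.2.2 (t + (-(n : ℤ) - 1 : ℤ) * (2 * Real.pi))
    rw [show t + (-(n : ℤ) - 1 : ℤ) * (2 * Real.pi) + 2 * Real.pi
      = t + (-(n : ℤ) : ℤ) * (2 * Real.pi) by push_cast; ring, ih] at h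
    apply σ.toLinearEquiv.injective
    refine h.symm.trans ?_
    rw [← LinearEquiv.mul_apply, ← zpow_one_add]
    congr 2
    ring

/-- Multiplication of a twisted loop by a smooth periodic function. -/
def smulPeriodic (f : periodicSmooth 𝕜) (u : twistedLoopAlgebra σ) : twistedLoopAlgebra σ :=
  ⟨fun t => (f : ℝ → 𝕜) t • (u : ℝ → L) t, fun l => by
    simp only [map_smul, smul_eq_mul]
    exact f.2.1.mul (u.2.1 l), fun t => by
    simp only [f.2.2 t, u.2.2 t, map_smul]⟩

/-- Evaluation of twisted loops at `t`. -/
def evalHom (σ : L ≃ₗ⁅𝕜⁆ L) (t : ℝ) : twistedLoopAlgebra σ →ₗ⁅𝕜⁆ L where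
  toFun u := (u : ℝ → L) t
  map_add' _ _ := rfl
  map_smul' _ _ := rfl
  map_lie' := rfl

theorem evalHom_surjective (σ : L ≃ₗ⁅𝕜⁆ L) (t : ℝ) : Function.Surjective (evalHom σ t) := fun x =>
  ⟨ofLocal σ t (isSmoothCurve_const x),
    ofLocal_apply_of_abs_sub_le (isSmoothCurve_const x) (by simp)⟩

theorem coe_lie_apply (u v : twistedLoopAlgebra σ) (t : ℝ) :
    ((⁅u, v⁆ : twistedLoopAlgebra σ) : ℝ → L) t = ⁅(u : ℝ → L) t, (v : ℝ → L) t⁆ := rfl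

theorem smulPeriodic_apply (f : periodicSmooth 𝕜) (u : twistedLoopAlgebra σ) (t : ℝ) :
    (smulPeriodic f u : ℝ → L) t = (f : ℝ → 𝕜) t • (u : ℝ → L) t := rfl

@[ext]
theorem ext {u v : twistedLoopAlgebra σ} (h : ∀ t, (u : ℝ → L) t = (v : ℝ → L) t) : u = v :=
  Subtype.ext (funext h)

theorem smulPeriodic_lie (f : periodicSmooth 𝕜) (u v : twistedLoopAlgebra σ) :
    ⁅smulPeriodic f u, v⁆ = smulPeriodic f ⁅u, v⁆ := by
  ext t; simp only [coe_lie_apply, smulPeriodic_apply, smul_lie]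

theorem lie_smulPeriodic (f : periodicSmooth 𝕜) (u v : twistedLoopAlgebra σ) :
    ⁅u, smulPeriodic f v⁆ = smulPeriodic f ⁅u, v⁆ := by
  ext t; simp only [coe_lie_apply, smulPeriodic_apply, lie_smul]

/-- `smulPeriodic f` as a linear map. -/
def smulPeriodicₗ (f : periodicSmooth 𝕜) : twistedLoopAlgebra σ →ₗ[𝕜] twistedLoopAlgebra σ where
  toFun := smulPeriodic f
  map_add' u v := ext fun t => smul_add ((f : ℝ → 𝕜) t) ((u : ℝ → L) t) ((v : ℝ → L) t)
  map_smul' c u := ext fun t => smul_comm ((f : ℝ → 𝕜) t) c ((u : ℝ → L) t)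

/-- A multiple of `u` by a function with value `1` at `s` is a combination of loops that take the
values of a basis at `s`, with the coordinates of `u` as coefficients at `s`. -/
theorem exists_smulPeriodic_eq_sum {ι : Type*} [Fintype ι] (b : Module.Basis ι 𝕜 L)
    (u : twistedLoopAlgebra σ) (s : ℝ) :
    ∃ (ρ : periodicSmooth 𝕜) (f : ι → periodicSmooth 𝕜), (ρ : ℝ → 𝕜) s = 1 ∧
      (∀ i, (f i : ℝ → 𝕜) s = b.repr ((u : ℝ → L) s) i) ∧
      smulPeriodic ρ u = ∑ i, smulPeriodic (f i) (ofLocal σ s (isSmoothCurve_const (b i))) := by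
  have hu : ∀ i, ContDiff ℝ ∞ (fun t => b.repr ((u : ℝ → L) t) i) := fun i => u.2.1 (b.coord i)
  let ρ₁ : periodicSmooth 𝕜 := periodicSmooth.ofLocal s (f := fun _ => 1) contDiff_const
  have hρ₁ : (ρ₁ : ℝ → 𝕜) s = 1 := periodicSmooth.ofLocal_apply_self s contDiff_const
  refine ⟨ρ₁ * ρ₁, fun i => periodicSmooth.ofLocal s (hu i), ?_,
    fun i => periodicSmooth.ofLocal_apply_self s (hu i), ?_⟩
  · change (ρ₁ : ℝ → 𝕜) s * (ρ₁ : ℝ → 𝕜) s = 1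
    rw [hρ₁, one_mul]
  ext t
  have hsum : ∀ v : ι → twistedLoopAlgebra σ,
      ((∑ i, v i : twistedLoopAlgebra σ) : ℝ → L) t = ∑ i, (v i : ℝ → L) t :=
    fun v => map_sum (evalHom σ t) v Finset.univ
  rw [hsum]
  set k := round ((t - s) / (2 * Real.pi))
  set β := cutoff 𝕜 s (t - k * (2 * Real.pi))
  have hone : ∀ x : 𝕜, ((1 : 𝕜 ≃ₗ[𝕜] 𝕜) ^ k) x = x := fun x => by rw [one_zpow]; rfl
  have h1 : (ρ₁ : ℝ → 𝕜) t = β := (hone (β * 1)).trans (mul_one β)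
  have h2 : ∀ i, (periodicSmooth.ofLocal s (hu i) : ℝ → 𝕜) t
      = β * b.repr ((u : ℝ → L) (t - k * (2 * Real.pi))) i := fun i => hone _
  have h3 : ∀ i, (ofLocal σ s (isSmoothCurve_const (𝕜 := 𝕜) (b i)) : ℝ → L) t
      = (σ.toLinearEquiv ^ k) (β • b i) := fun i => rfl
  have h4 : (u : ℝ → L) t = (σ.toLinearEquiv ^ k) ((u : ℝ → L) (t - k * (2 * Real.pi))) := by
    rw [← apply_add_int_mul, sub_add_cancel]
  simp only [smulPeriodic_apply, h2, h3]
  change ((ρ₁ : ℝ → 𝕜) t * (ρ₁ : ℝ → 𝕜) t) • (u : ℝ → L) t = _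
  rw [h1, h4]
  conv_lhs => rw [← b.sum_repr ((u : ℝ → L) (t - k * (2 * Real.pi)))]
  rw [map_sum, Finset.smul_sum]
  refine Finset.sum_congr rfl fun i _ => ?_
  rw [map_smul, map_smul, smul_smul, smul_smul]
  congr 1
  ring

end twistedLoopAlgebra

end TwistedLoop

/-! ### Homomorphisms onto a simple Lie algebra are evaluations -/

section Evaluation

open twistedLoopAlgebra

variable {𝕜 : Type*} [RCLike 𝕜]
  {L : Type*} [LieRing L] [LieAlgebra 𝕜 L] [FiniteDimensional 𝕜 L]
  {L' : Type*} [LieRing L'] [LieAlgebra 𝕜 L'] [FiniteDimensional 𝕜 L']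
  {σ : L ≃ₗ⁅𝕜⁆ L} {σ' : L' ≃ₗ⁅𝕜⁆ L'}

/-- The kernel of `ψ` is stable under periodic functions because the centre of `L'` is trivial, so
a periodic function acts on `L'` by an element of the centroid. -/
theorem exists_map_smulPeriodic_eq_smul [LieAlgebra.IsSimple 𝕜 L'] (hL' : IsCompactIfReal 𝕜 L')
    (ψ : twistedLoopAlgebra σ →ₗ⁅𝕜⁆ L') (hψ : Function.Surjective ψ) (f : periodicSmooth 𝕜) :
    ∃ c : 𝕜, ∀ u, ψ (smulPeriodic f u) = c • ψ u := by
  have hker : ∀ u, ψ u = 0 → ψ (smulPeriodic f u) = 0 := fun u hu =>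
    LieAlgebra.IsSimple.eq_zero_of_forall_lie_eq_zero (𝕜 := 𝕜) fun y => by
      obtain ⟨v, rfl⟩ := hψ y
      rw [← LieHom.map_lie, smulPeriodic_lie, ← lie_smulPeriodic, LieHom.map_lie, hu, zero_lie]
  obtain ⟨r, hr⟩ := (ψ : twistedLoopAlgebra σ →ₗ[𝕜] L').exists_rightInverse_of_surjective
    (LinearMap.range_eq_top.2 hψ)
  have hr' : ∀ y, ψ (r y) = y := fun y => LinearMap.congr_fun hr y
  let T : Module.End 𝕜 L' := (ψ : twistedLoopAlgebra σ →ₗ[𝕜] L') ∘ₗ smulPeriodicₗ f ∘ₗ r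
  have hT : ∀ u, T (ψ u) = ψ (smulPeriodic f u) := fun u => by
    rw [← sub_eq_zero]
    have := hker (r (ψ u) - u) (by rw [map_sub, hr', sub_self])
    rw [← this]
    change ψ _ - ψ _ = ψ (smulPeriodicₗ f (r (ψ u) - u))
    rw [map_sub, map_sub]
    rfl
  obtain ⟨c, hc⟩ := exists_eq_smul_of_map_lie hL' T fun x y => by
    obtain ⟨u, rfl⟩ := hψ x
    obtain ⟨v, rfl⟩ := hψ y
    rw [← LieHom.map_lie, hT, hT, ← smulPeriodic_lie, LieHom.map_lie]
  exact ⟨c, fun u => by rw [← hT, hc]⟩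

/-- The scalars by which periodic functions act form a character, hence an evaluation. -/
theorem exists_map_smulPeriodic_eq_apply_smul [LieAlgebra.IsSimple 𝕜 L']
    (hL' : IsCompactIfReal 𝕜 L') (ψ : twistedLoopAlgebra σ →ₗ⁅𝕜⁆ L')
    (hψ : Function.Surjective ψ) :
    ∃ s : ℝ, ∀ (f : periodicSmooth 𝕜) u, ψ (smulPeriodic f u) = (f : ℝ → 𝕜) s • ψ u := by
  choose c hc using exists_map_smulPeriodic_eq_smul hL' ψ hψ
  have : Nontrivial L' := LieAlgebra.IsSimple.nontrivial 𝕜 L'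
  obtain ⟨x, hx⟩ := exists_ne (0 : L')
  obtain ⟨u₀, rfl⟩ := hψ x
  have huniq : ∀ f a, ψ (smulPeriodic f u₀) = a • ψ u₀ → c f = a := fun f a h =>
    smul_left_injective 𝕜 hx ((hc f u₀).symm.trans h)
  let χ : periodicSmooth 𝕜 →ₐ[𝕜] 𝕜 :=
    { toFun := c
      map_one' := huniq _ _ (by
        rw [one_smul]; congr 1; ext t; exact one_smul 𝕜 _)
      map_zero' := huniq _ _ (by
        rw [zero_smul, ← map_zero ψ]; congr 1; ext t; exact zero_smul 𝕜 _)
      map_add' := fun f g => huniq _ _ (by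
        rw [add_smul, ← hc, ← hc, ← map_add]; congr 1; ext t; exact add_smul _ _ _)
      map_mul' := fun f g => huniq _ _ (by
        rw [mul_smul, ← hc g, ← hc f]; congr 1; ext t; exact mul_smul _ _ _)
      commutes' := fun a => huniq _ _ (by
        rw [Algebra.algebraMap_self_apply, ← map_smul]; congr 1) }
  obtain ⟨s, hs⟩ := periodicSmooth.exists_character_eq_eval χ
  exact ⟨s, fun f u => by rw [hc, ← hs]; rfl⟩

/-- A homomorphism onto a simple Lie algebra is an evaluation followed by an isomorphism. -/
theorem exists_lieEquiv_apply_eq [LieAlgebra.IsSimple 𝕜 L] [LieAlgebra.IsSimple 𝕜 L']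
    (hL' : IsCompactIfReal 𝕜 L') (ψ : twistedLoopAlgebra σ →ₗ⁅𝕜⁆ L')
    (hψ : Function.Surjective ψ) :
    ∃ (s : ℝ) (Φ : L ≃ₗ⁅𝕜⁆ L'), ∀ u, ψ u = Φ ((u : ℝ → L) s) := by
  obtain ⟨s, hs⟩ := exists_map_smulPeriodic_eq_apply_smul hL' ψ hψ
  let b := Module.finBasis 𝕜 L
  let Φ₀ : L →ₗ[𝕜] L' := b.constr 𝕜 fun i => ψ (ofLocal σ s (isSmoothCurve_const (b i)))
  have hΦ₀ : ∀ u, ψ u = Φ₀ ((u : ℝ → L) s) := by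
    intro u
    obtain ⟨ρ, f, hρ, hf, h⟩ := exists_smulPeriodic_eq_sum b u s
    have h1 := congrArg ψ h
    rw [hs, hρ, one_smul, map_sum] at h1
    rw [h1, Module.Basis.constr_apply_fintype]
    refine Finset.sum_congr rfl fun i _ => ?_
    rw [hs, hf]
    rfl
  let Φ₁ : L →ₗ⁅𝕜⁆ L' :=
    { Φ₀ with
      map_lie' := by
        intro x y
        obtain ⟨u, rfl⟩ := evalHom_surjective σ s x
        obtain ⟨v, rfl⟩ := evalHom_surjective σ s y
        change Φ₀ ⁅(u : ℝ → L) s, (v : ℝ → L) s⁆ = ⁅Φ₀ ((u : ℝ → L) s), Φ₀ ((v : ℝ → L) s)⁆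
        rw [← hΦ₀, ← hΦ₀, ← LieHom.map_lie, hΦ₀]
        rfl }
  have hsurj : Function.Surjective Φ₁ := fun y => by
    obtain ⟨u, rfl⟩ := hψ y
    exact ⟨(u : ℝ → L) s, (hΦ₀ u).symm⟩
  have : Nontrivial L' := LieAlgebra.IsSimple.nontrivial 𝕜 L'
  have hinj : Function.Injective Φ₁ := by
    rw [← LieHom.ker_eq_bot]
    refine (LieAlgebra.IsSimple.eq_bot_or_eq_top (R := 𝕜) Φ₁.ker).resolve_right fun h => ?_
    obtain ⟨y, hy⟩ := exists_ne (0 : L')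
    obtain ⟨x, rfl⟩ := hsurj y
    exact hy (LieHom.mem_ker.1 (h ▸ LieSubmodule.mem_top x))
  exact ⟨s, LieEquiv.ofBijective Φ₁ ⟨hinj, hsurj⟩, hΦ₀⟩

end Evaluation

/-! ### The reparametrization and the curve of isomorphisms -/

section Standard

open twistedLoopAlgebra

variable {𝕜 : Type*} [RCLike 𝕜]
  {L : Type*} [LieRing L] [LieAlgebra 𝕜 L] [FiniteDimensional 𝕜 L]
  {L' : Type*} [LieRing L'] [LieAlgebra 𝕜 L'] [FiniteDimensional 𝕜 L']
  {σ : L ≃ₗ⁅𝕜⁆ L} {σ' : L' ≃ₗ⁅𝕜⁆ L'}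

/-- If the value of loops at `s` determines their value at `t`, then `s` and `t` agree modulo `2π`,
because periodic functions separate points modulo `2π`. -/
theorem eq_add_of_forall_apply_eq [Nontrivial L] {s t : ℝ} (Ψ : L →ₗ[𝕜] L)
    (h : ∀ u : twistedLoopAlgebra σ, (u : ℝ → L) t = Ψ ((u : ℝ → L) s)) :
    ∃ k : ℤ, t = s + k * (2 * Real.pi) := by
  obtain ⟨x, hx⟩ := exists_ne (0 : L)
  obtain ⟨u, hu⟩ := evalHom_surjective σ t x
  change (u : ℝ → L) t = x at hu
  have key : ∀ f : periodicSmooth 𝕜, (f : ℝ → 𝕜) t = (f : ℝ → 𝕜) s := by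
    intro f
    have := h (smulPeriodic f u)
    rw [smulPeriodic_apply, smulPeriodic_apply, map_smul, ← h, hu] at this
    exact smul_left_injective 𝕜 hx this
  exact periodicSmooth.exists_eq_add_of_cos_eq_of_sin_eq (key _) (key _)

/-- Periodic functions pull back to smooth functions along a reparametrization, since
`(f ∘ lam) • φ u = φ (f • u)` is smooth and some `φ u` does not vanish at a given point. -/
theorem contDiff_comp_of_forall_apply_eq [Nontrivial L']
    (φ : twistedLoopAlgebra σ ≃ₗ⁅𝕜⁆ twistedLoopAlgebra σ') {lam : ℝ → ℝ} {Φ : ℝ → (L ≃ₗ⁅𝕜⁆ L')}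
    (h : ∀ u t, (φ u : ℝ → L') t = Φ t ((u : ℝ → L) (lam t))) (f : periodicSmooth 𝕜) :
    ContDiff ℝ ∞ (fun t => (f : ℝ → 𝕜) (lam t)) := by
  rw [contDiff_iff_contDiffAt]
  intro t₀
  obtain ⟨x, hx⟩ := exists_ne (0 : L')
  obtain ⟨w, hw⟩ := evalHom_surjective σ' t₀ x
  change (w : ℝ → L') t₀ = x at hw
  obtain ⟨l, hl⟩ : ∃ l : Module.Dual 𝕜 L', l x ≠ 0 := by
    by_contra! hno
    exact hx ((Module.forall_dual_apply_eq_zero_iff 𝕜 x).1 hno)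
  have hmul : ∀ t, l ((φ (smulPeriodic f (φ.symm w)) : ℝ → L') t)
      = (f : ℝ → 𝕜) (lam t) * l ((w : ℝ → L') t) := by
    intro t
    have h1 := h (φ.symm w) t
    rw [LieEquiv.apply_symm_apply] at h1
    rw [h, smulPeriodic_apply, map_smul, map_smul, smul_eq_mul, h1]
  have hws := w.2.1 l
  have hne : l ((w : ℝ → L') t₀) ≠ 0 := by rwa [hw]
  refine (((φ (smulPeriodic f (φ.symm w))).2.1 l).contDiffAt.mul
    (hws.contDiffAt.inv hne)).congr_of_eventuallyEq ?_
  filter_upwards [hws.continuous.continuousAt.eventually_ne hne] with t ht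
  rw [hmul, Pi.inv_apply, mul_assoc, mul_inv_cancel₀ ht, mul_one]

/-- The reparametrization is determined only modulo `2π`; lifting the smooth curve
`(cos ∘ lam, sin ∘ lam)` makes it smooth, and the isomorphisms `Φ t` change by powers of `σ`. -/
theorem exists_contDiff_forall_apply_eq [LieAlgebra.IsSimple 𝕜 L] [LieAlgebra.IsSimple 𝕜 L']
    (hL' : IsCompactIfReal 𝕜 L') (φ : twistedLoopAlgebra σ ≃ₗ⁅𝕜⁆ twistedLoopAlgebra σ') :
    ∃ (lam : ℝ → ℝ) (Φ : ℝ → (L ≃ₗ⁅𝕜⁆ L')), ContDiff ℝ ∞ lam ∧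
      ∀ u t, (φ u : ℝ → L') t = Φ t ((u : ℝ → L) (lam t)) := by
  have : Nontrivial L' := LieAlgebra.IsSimple.nontrivial 𝕜 L'
  choose lam₀ Φ₀ h₀ using fun t => exists_lieEquiv_apply_eq hL'
    ((evalHom σ' t).comp φ.toLieHom) ((evalHom_surjective σ' t).comp φ.surjective)
  have h₀' : ∀ u t, (φ u : ℝ → L') t = Φ₀ t ((u : ℝ → L) (lam₀ t)) := fun u t => h₀ t u
  have hcos : ContDiff ℝ ∞ (fun t => Real.cos (lam₀ t)) := by
    have := (RCLike.reCLM (K := 𝕜)).contDiff.comp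
      (contDiff_comp_of_forall_apply_eq φ h₀' (periodicSmooth.cos 𝕜))
    convert this using 1
    exact funext fun t => (RCLike.ofReal_re (K := 𝕜) _).symm
  have hsin : ContDiff ℝ ∞ (fun t => Real.sin (lam₀ t)) := by
    have := (RCLike.reCLM (K := 𝕜)).contDiff.comp
      (contDiff_comp_of_forall_apply_eq φ h₀' (periodicSmooth.sin 𝕜))
    convert this using 1
    exact funext fun t => (RCLike.ofReal_re (K := 𝕜) _).symm
  obtain ⟨lam, hlam, hcs⟩ := exists_contDiff_cos_eq_sin_eq hcos hsin
    fun t => Real.cos_sq_add_sin_sq _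
  have hΦ : ∀ t, ∃ Φ : L ≃ₗ⁅𝕜⁆ L', ∀ u, (φ u : ℝ → L') t = Φ ((u : ℝ → L) (lam t)) := by
    intro t
    obtain ⟨k, hk⟩ := periodicSmooth.exists_eq_add_of_cos_eq_of_sin_eq (𝕜 := 𝕜)
      (s := lam₀ t) (t := lam t) (congrArg ((↑) : ℝ → 𝕜) (hcs t).1.symm)
      (congrArg ((↑) : ℝ → 𝕜) (hcs t).2.symm)
    -- `σ ^ k` preserves the bracket because `u (2πk) = (σ ^ k) (u 0)` for twisted loops `u`.
    have hpow : ∀ x y : L, (σ.toLinearEquiv ^ k) ⁅x, y⁆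
        = ⁅(σ.toLinearEquiv ^ k) x, (σ.toLinearEquiv ^ k) y⁆ := by
      intro x y
      obtain ⟨u, rfl⟩ := evalHom_surjective σ 0 x
      obtain ⟨v, rfl⟩ := evalHom_surjective σ 0 y
      rw [← LieHom.map_lie]
      change (σ.toLinearEquiv ^ k) (((⁅u, v⁆ : twistedLoopAlgebra σ) : ℝ → L) 0) =
        ⁅(σ.toLinearEquiv ^ k) ((u : ℝ → L) 0), (σ.toLinearEquiv ^ k) ((v : ℝ → L) 0)⁆
      rw [← apply_add_int_mul, ← apply_add_int_mul, ← apply_add_int_mul]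
      rfl
    let e : L ≃ₗ⁅𝕜⁆ L := { σ.toLinearEquiv ^ k with map_lie' := hpow _ _ }
    refine ⟨e.trans (Φ₀ t), fun u => ?_⟩
    rw [h₀', hk, apply_add_int_mul]
    rfl
  choose Φ hΦ using hΦ
  exact ⟨lam, Φ, hlam, fun u t => hΦ t u⟩

/-- Near `t₀` the value `Φ t x` is `φ u t` for a loop `u` that is constantly `x` near `lam t₀`. -/
theorem isSmoothCurve_of_forall_apply_eq
    (φ : twistedLoopAlgebra σ ≃ₗ⁅𝕜⁆ twistedLoopAlgebra σ') {lam : ℝ → ℝ} (hlam : Continuous lam)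
    {Φ : ℝ → (L ≃ₗ⁅𝕜⁆ L')} (h : ∀ u t, (φ u : ℝ → L') t = Φ t ((u : ℝ → L) (lam t))) :
    IsSmoothCurve 𝕜 (fun t => ((Φ t).toLinearEquiv : L →ₗ[𝕜] L')) := by
  have hx : ∀ x, IsSmoothCurve 𝕜 (fun t => Φ t x) := by
    intro x l
    rw [contDiff_iff_contDiffAt]
    intro t₀
    refine ((φ (ofLocal σ (lam t₀) (isSmoothCurve_const x))).2.1
      l).contDiffAt.congr_of_eventuallyEq ?_
    filter_upwards [hlam.continuousAt.preimage_mem_nhds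
      (Metric.closedBall_mem_nhds (lam t₀) one_pos)] with t ht
    rw [Set.mem_preimage, Metric.mem_closedBall, Real.dist_eq] at ht
    rw [h, ofLocal_apply_of_abs_sub_le _ ht]
  intro l
  let b := Module.finBasis 𝕜 L
  have hsum : (fun t => l ((Φ t).toLinearEquiv : L →ₗ[𝕜] L')) =
      fun t => ∑ i, (l ∘ₗ LinearMap.smulRightₗ (b.coord i)) (Φ t (b i)) := by
    funext t
    simp only [LinearMap.comp_apply]
    rw [← map_sum]
    congr 1
    refine b.ext fun j => ?_
    rw [LinearMap.sum_apply, Finset.sum_eq_single j]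
    · simp
    · intro i _ hij
      simp [hij.symm]
    · simp
  rw [hsum]
  exact ContDiff.sum fun i _ => hx (b i) _

/-- A reparametrization commutes with `2π`-translation up to an integral degree, because `φ u` is
determined at `t + 2π` by its value at `t`. -/
theorem exists_int_forall_apply_add_two_pi [Nontrivial L]
    (φ : twistedLoopAlgebra σ ≃ₗ⁅𝕜⁆ twistedLoopAlgebra σ') {lam : ℝ → ℝ} (hlam : Continuous lam)
    {Φ : ℝ → (L ≃ₗ⁅𝕜⁆ L')} (h : ∀ u t, (φ u : ℝ → L') t = Φ t ((u : ℝ → L) (lam t))) :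
    ∃ n : ℤ, ∀ t, lam (t + 2 * Real.pi) = lam t + n * (2 * Real.pi) := by
  obtain ⟨n, hn⟩ := exists_eq_of_continuous_of_forall_exists_int
    (f := fun t => lam (t + 2 * Real.pi) - lam t) (by fun_prop) (a := 2 * Real.pi)
    (by positivity) fun t => by
      obtain ⟨k, hk⟩ := eq_add_of_forall_apply_eq (σ := σ) (s := lam t) (t := lam (t + 2 * Real.pi))
        ((Φ (t + 2 * Real.pi)).symm.toLinearEquiv.toLinearMap ∘ₗ σ'.toLinearEquiv.toLinearMap ∘ₗ
          (Φ t).toLinearEquiv.toLinearMap) fun u => by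
        change _ = (Φ (t + 2 * Real.pi)).symm (σ' (Φ t ((u : ℝ → L) (lam t))))
        rw [← h, ← (φ u).2.2, h, LieEquiv.symm_apply_apply]
      exact ⟨k, by rw [hk]; ring⟩
  exact ⟨n, fun t => by linarith [hn t]⟩

/-- The reparametrizations of `φ` and of its inverse are inverse to each other up to a translation,
by `φ.symm (φ u) = u` and the uniqueness of reparametrizations modulo `2π`. -/
theorem exists_int_forall_comp_eq_add [Nontrivial L]
    (φ : twistedLoopAlgebra σ ≃ₗ⁅𝕜⁆ twistedLoopAlgebra σ') {lam mu : ℝ → ℝ}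
    (hlam : Continuous lam) (hmu : Continuous mu) {Φ : ℝ → (L ≃ₗ⁅𝕜⁆ L')} {Ψ : ℝ → (L' ≃ₗ⁅𝕜⁆ L)}
    (h : ∀ u t, (φ u : ℝ → L') t = Φ t ((u : ℝ → L) (lam t)))
    (h' : ∀ v t, (φ.symm v : ℝ → L) t = Ψ t ((v : ℝ → L') (mu t))) :
    ∃ k : ℤ, ∀ t, lam (mu t) = t + k * (2 * Real.pi) := by
  obtain ⟨n, hn⟩ := exists_eq_of_continuous_of_forall_exists_int
    (f := fun t => lam (mu t) - t) (by fun_prop) (a := 2 * Real.pi)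
    (by positivity) fun t => by
      obtain ⟨k, hk⟩ := eq_add_of_forall_apply_eq (σ := σ) (s := lam (mu t)) (t := t)
        ((Ψ t).toLinearEquiv.toLinearMap ∘ₗ (Φ (mu t)).toLinearEquiv.toLinearMap) fun u => by
        change _ = Ψ t (Φ (mu t) ((u : ℝ → L) (lam (mu t))))
        rw [← h, ← h', LieEquiv.symm_apply_apply]
      exact ⟨-k, by push_cast; linarith⟩
  exact ⟨n, fun t => by linarith [hn t]⟩

end Standard

theorem theorem3p1 {𝕜 : Type*} [RCLike 𝕜]
    {L : Type*} [LieRing L] [LieAlgebra 𝕜 L] [FiniteDimensional 𝕜 L]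
    [LieAlgebra.IsSimple 𝕜 L] (hL : IsCompactIfReal 𝕜 L)
    {L' : Type*} [LieRing L'] [LieAlgebra 𝕜 L'] [FiniteDimensional 𝕜 L']
    [LieAlgebra.IsSimple 𝕜 L'] (hL' : IsCompactIfReal 𝕜 L')
    (σ : L ≃ₗ⁅𝕜⁆ L) (σ' : L' ≃ₗ⁅𝕜⁆ L')
    (φ : twistedLoopAlgebra σ ≃ₗ⁅𝕜⁆ twistedLoopAlgebra σ') :
    IsStandard φ := by
  have : Nontrivial L := LieAlgebra.IsSimple.nontrivial 𝕜 L
  have : Nontrivial L' := LieAlgebra.IsSimple.nontrivial 𝕜 L'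
  obtain ⟨lam, Φ, hlam, hφ⟩ := exists_contDiff_forall_apply_eq hL' φ
  obtain ⟨mu, Ψ, hmu, hφ'⟩ := exists_contDiff_forall_apply_eq hL φ.symm
  obtain ⟨ε, hε⟩ := exists_int_forall_apply_add_two_pi φ hlam.continuous hφ
  obtain ⟨δ, hδ⟩ := exists_int_forall_apply_add_two_pi φ.symm hmu.continuous hφ'
  obtain ⟨k, hk⟩ := exists_int_forall_comp_eq_add φ hlam.continuous hmu.continuous hφ hφ'
  obtain ⟨m, hm⟩ := exists_int_forall_comp_eq_add φ.symm hmu.continuous hlam.continuous hφ' hφ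
  have hπ : (2 * Real.pi) ≠ 0 := by positivity
  have hlamZ : ∀ t (n : ℤ), lam (t + n * (2 * Real.pi)) = lam t + (n * ε : ℤ) * (2 * Real.pi) := by
    have hper : Function.Periodic (fun t => lam t - ε * t) (2 * Real.pi) := fun t => by
      simp only [hε]; ring
    intro t n
    have := hper.int_mul n t
    push_cast
    linear_combination this
  have hεδ : δ * ε = 1 := by
    have h1 := hk (0 + 2 * Real.pi)
    rw [hδ, hlamZ, hk] at h1
    have h2 : ((δ * ε : ℤ) : ℝ) = 1 := mul_right_cancel₀ hπ (by linear_combination h1)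
    exact_mod_cast h2
  have hinv : ∀ t, lam (mu (t - k * (2 * Real.pi))) = t := fun t => by rw [hk]; ring
  have hinj : Function.Injective lam := fun x y hxy => by
    have := hm x
    rw [hxy, hm] at this
    linarith
  refine ⟨ε, ⟨⟨lam, fun t => mu (t - k * (2 * Real.pi)), fun t => hinj (hinv _), hinv⟩,
    hlam.contMDiff, (hmu.comp (contDiff_id.sub contDiff_const)).contMDiff⟩, Φ,
    Int.isUnit_iff.1 (IsUnit.of_mul_eq_one δ (by rw [mul_comm, hεδ])), hε,
    isSmoothCurve_of_forall_apply_eq φ hlam.continuous hφ, fun t x => ?_, hφ⟩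
  obtain ⟨u, rfl⟩ := twistedLoopAlgebra.evalHom_surjective σ (lam (t + 2 * Real.pi)) x
  change Φ (t + 2 * Real.pi) ((u : ℝ → L) (lam (t + 2 * Real.pi)))
    = σ' (Φ t ((σ.toLinearEquiv ^ (-ε)) ((u : ℝ → L) (lam (t + 2 * Real.pi)))))
  have ht : lam (t + 2 * Real.pi) + (-ε : ℤ) * (2 * Real.pi) = lam t := by
    rw [hε]; push_cast; ring
  rw [← twistedLoopAlgebra.apply_add_int_mul, ht, ← hφ, ← hφ]
  exact (φ u).2.2 t
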